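/- Let $\mathbb{H}^3$ be oriented hyperbolic 3-space, and let $\mathrm{Spin}\cong SL(2,\mathbb{C})$ be the double (universal) cover of its bundle $\mathrm{Fr}\cong PSL(2,\mathbb{C})$ of right-handed orthonormal frames; its points are called spin frames. Rotations and parallel translations of spin frames are defined by lifting the corresponding continuous paths of frames. For a horosphere $h$, let $N^{out}$ be its unit normal pointing towards its centre and $N^{in}=-N^{out}$. A spin-decorated horosphere is a horosphere $h$ with a pair $W=(W^{in},W^{out})$, where, for some unit parallel tangent vector field $V$ on $h$ (that is, one invariant under the parabolic isometries preserving $h$), $W^{in}$ and $W^{out}$ are continuous lifts to $\mathrm{Spin}$ of the frame fields $(N^{in},V,N^{in}\times V)$ and $(N^{out},V,N^{out}\times V)$ along $h$, such that $W^{in}$ is obtained from $W^{out}$ by rotation by $\pi$ about $V$ (equivalently, $W^{out}$ is obtained from $W^{in}$ by rotation by $-\pi$ about $V$). The complex lambda length $\lambda$ from $(h,W)$ to $(h',W')$ is $0$ if $h,h'$ have the same centre. Otherwise let $\gamma$ be the oriented geodesic from the centre of $h$ to the centre of $h'$, meeting them at $q$ and $q'$. Then $\lambda=\exp\left(\tfrac12(\rho+i\theta)\right)$,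 where parallel translation along $\gamma$ by signed distance $\rho$ followed by rotation about $\gamma$ by angle $\theta$ takes the spin frame $W^{in}(q)$ to $W'^{out}(q')$; here $\theta$ is determined modulo $4\pi$. Theorem. Let $(h_i,W_i)$, $i=0,1,2,3$, be any four spin-decorated horospheres in $\mathbb{H}^3$ (for example, horospheres about the vertices of an ideal tetrahedron). Then the complex lambda lengths $\lambda_{ij}$ from $(h_i,W_i)$ to $(h_j,W_j)$ are well-defined complex numbers, and $$\lambda_{02}\lambda_{13}=\lambda_{01}\lambda_{23}+\lambda_{03}\lambda_{12}.$$ -/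

import Mathlib

open scoped MatrixGroups

namespace SpinHoro

/-- Minkowski space `ℝ^{1,3}` with coordinates `(T, X, Y, Z)`. -/
abbrev Mink : Type := Fin 4 → ℝ

/-- The Minkowski inner product `TT' - XX' - YY' - ZZ'`. -/
def mink (p p' : Mink) : ℝ := p 0 * p' 0 - p 1 * p' 1 - p 2 * p' 2 - p 3 * p' 3

/-- The positive light cone `L⁺`. Its rays are the points at infinity of hyperbolic space. -/
def lightCone : Set Mink := {p | mink p p = 0 ∧ 0 < p 0}

/-- Hyperbolic 3-space `ℍ³` in the hyperboloid model. The tangent space at `q` is the Minkowski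
orthogonal complement of `q`, with Riemannian metric `-mink`. -/
def H3 : Set Mink := {x | mink x x = 1 ∧ 0 < x 0}

/-- The cross product `v × w` of tangent vectors at `q ∈ ℍ³`: the tangent vector `c` at `q` with
`-mink c x = det (q, v, w, x)` for all `x`. The orientation of `ℍ³` is the one for which the
directions `X, Y, Z` at `(1, 0, 0, 0)` are right-handed. -/
noncomputable def cross (q v w : Mink) : Mink := fun i =>
  (if i = 0 then -1 else 1) * Matrix.det (Matrix.of ![q, v, w, Pi.single i 1])

/-! ### Right-handed orthonormal frames -/

/-- A right-handed orthonormal frame `(e₁, e₂, e₃)` at a point of `ℍ³`. It is determined by the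
point and `e₁, e₂`; the third vector is `Frame.e₃`, equal to `e₁ × e₂`. -/
@[ext] structure Frame where
  pt : Mink
  e₁ : Mink
  e₂ : Mink
  pt_mem : pt ∈ H3
  tan₁ : mink pt e₁ = 0
  tan₂ : mink pt e₂ = 0
  unit₁ : mink e₁ e₁ = -1
  unit₂ : mink e₂ e₂ = -1
  orth : mink e₁ e₂ = 0

/-- The third vector of a frame. -/
noncomputable def Frame.e₃ (f : Frame) : Mink := cross f.pt f.e₁ f.e₂

theorem cross_apply (q v w : Mink) : cross q v w =
    ![-(q 1 * (v 3 * w 2 - v 2 * w 3) + q 2 * (v 1 * w 3 - v 3 * w 1)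
        + q 3 * (v 2 * w 1 - v 1 * w 2)),
      q 0 * (v 2 * w 3 - v 3 * w 2) - q 2 * (v 0 * w 3 - v 3 * w 0)
        + q 3 * (v 0 * w 2 - v 2 * w 0),
      -(q 0 * (v 1 * w 3 - v 3 * w 1) - q 1 * (v 0 * w 3 - v 3 * w 0)
        + q 3 * (v 0 * w 1 - v 1 * w 0)),
      q 0 * (v 1 * w 2 - v 2 * w 1) - q 1 * (v 0 * w 2 - v 2 * w 0)
        + q 2 * (v 0 * w 1 - v 1 * w 0)] := by
  ext i
  fin_cases i <;>
    simp [cross, Matrix.det_succ_row_zero, Fin.sum_univ_succ, Fin.succAbove, Pi.single_apply] <;>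
    ring

theorem mink_cross_self (q v w : Mink) : mink (cross q v w) (cross q v w) =
    -(mink q q * (mink v v * mink w w - mink v w ^ 2)
      - mink q v * (mink q v * mink w w - mink v w * mink q w)
      + mink q w * (mink q v * mink v w - mink v v * mink q w)) := by
  rw [cross_apply]; simp [mink]; ring

theorem mink_cross_left (q v w : Mink) : mink q (cross q v w) = 0 := by
  rw [cross_apply]; simp [mink]; ring

theorem mink_cross_mid (q v w : Mink) : mink v (cross q v w) = 0 := by
  rw [cross_apply]; simp [mink]; ring

theorem mink_cross_right (q v w : Mink) : mink w (cross q v w) = 0 := by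
  rw [cross_apply]; simp [mink]; ring

theorem mink_comm (p q : Mink) : mink p q = mink q p := by simp only [mink]; ring

theorem mink_comb_right (p x y : Mink) (a b : ℝ) :
    mink p (a • x + b • y) = a * mink p x + b * mink p y := by
  simp [mink]; ring

theorem mink_comb_left (p x y : Mink) (a b : ℝ) :
    mink (a • x + b • y) p = a * mink x p + b * mink y p := by
  simp [mink]; ring

theorem Frame.unit₃ (f : Frame) : mink f.e₃ f.e₃ = -1 := by
  rw [Frame.e₃, mink_cross_self, f.tan₁, f.tan₂, f.unit₁, f.unit₂, f.orth, f.pt_mem.1]; norm_num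

/-- A future-pointing unit vector and a unit vector orthogonal to it span a geodesic, which stays
in the upper sheet of the hyperboloid. -/
theorem translate_mem {q v : Mink} (hq : q ∈ H3) (hqv : mink q v = 0) (hv : mink v v = -1)
    (s : ℝ) : Real.cosh s • q + Real.sinh s • v ∈ H3 := by
  obtain ⟨h1, h0⟩ := hq
  have hs := Real.cosh_sq s
  refine ⟨?_, ?_⟩
  · rw [mink_comb_right, mink_comb_left, mink_comb_left, mink_comm v q, h1, hqv, hv]
    linear_combination hs
  · have hlt : v 0 ^ 2 < q 0 ^ 2 := by
      simp only [mink] at h1 hqv hv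
      have e1 : q 1 ^ 2 + q 2 ^ 2 + q 3 ^ 2 = q 0 ^ 2 - 1 := by linarith
      have e2 : v 1 ^ 2 + v 2 ^ 2 + v 3 ^ 2 = v 0 ^ 2 + 1 := by linarith
      have e3 : q 1 * v 1 + q 2 * v 2 + q 3 * v 3 = q 0 * v 0 := by linarith
      have cs : (q 1 * v 1 + q 2 * v 2 + q 3 * v 3) ^ 2 ≤
          (q 1 ^ 2 + q 2 ^ 2 + q 3 ^ 2) * (v 1 ^ 2 + v 2 ^ 2 + v 3 ^ 2) := by
        nlinarith [sq_nonneg (q 1 * v 2 - q 2 * v 1), sq_nonneg (q 1 * v 3 - q 3 * v 1),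
          sq_nonneg (q 2 * v 3 - q 3 * v 2)]
      rw [e1, e2, e3] at cs
      nlinarith
    have hc := Real.cosh_pos s
    have hlt' : |Real.sinh s * v 0| < Real.cosh s * q 0 := by
      apply abs_lt_of_sq_lt_sq _ (by positivity)
      rw [mul_pow, mul_pow, hs]
      nlinarith [sq_nonneg (Real.sinh s), sq_nonneg (v 0)]
    have := (abs_lt.mp hlt').1
    simp only [Pi.add_apply, Pi.smul_apply, smul_eq_mul]
    linarith

/-- Parallel translation of a frame by signed distance `s` along the oriented geodesic through its
point in the direction `e₁`. The vectors `e₂, e₃` are constant along this geodesic as vectors of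
Minkowski space. -/
noncomputable def Frame.translate (f : Frame) (s : ℝ) : Frame where
  pt := Real.cosh s • f.pt + Real.sinh s • f.e₁
  e₁ := Real.sinh s • f.pt + Real.cosh s • f.e₁
  e₂ := f.e₂
  pt_mem := translate_mem f.pt_mem f.tan₁ f.unit₁ s
  tan₁ := by
    rw [mink_comb_right, mink_comb_left, mink_comb_left, mink_comm f.e₁ f.pt, f.pt_mem.1, f.tan₁,
      f.unit₁]
    ring
  tan₂ := by rw [mink_comb_left, f.tan₂, f.orth]; ring
  unit₁ := by
    rw [mink_comb_right, mink_comb_left, mink_comb_left, mink_comm f.e₁ f.pt, f.pt_mem.1, f.tan₁,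
      f.unit₁]
    linear_combination -(Real.cosh_sq s)
  unit₂ := f.unit₂
  orth := by rw [mink_comb_left, f.tan₂, f.orth]; ring

/-- Right-handed rotation of a frame by angle `t` about its first vector. -/
noncomputable def Frame.rotate₁ (f : Frame) (t : ℝ) : Frame where
  pt := f.pt
  e₁ := f.e₁
  e₂ := Real.cos t • f.e₂ + Real.sin t • f.e₃
  pt_mem := f.pt_mem
  tan₁ := f.tan₁
  tan₂ := by rw [mink_comb_right, f.tan₂, Frame.e₃, mink_cross_left]; ring
  unit₁ := f.unit₁
  unit₂ := by
    have h : mink f.e₂ f.e₃ = 0 := mink_cross_right _ _ _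
    rw [mink_comb_right, mink_comb_left, mink_comb_left, mink_comm f.e₃ f.e₂, f.unit₂, h, f.unit₃]
    linear_combination -(Real.sin_sq_add_cos_sq t)
  orth := by rw [mink_comb_right, f.orth, Frame.e₃, mink_cross_mid]; ring

/-- Right-handed rotation of a frame by angle `t` about its second vector. As `e₂ × e₃ = e₁`, it
takes `e₁` to `cos t • e₁ - sin t • e₃`. -/
noncomputable def Frame.rotate₂ (f : Frame) (t : ℝ) : Frame where
  pt := f.pt
  e₁ := Real.cos t • f.e₁ + (-Real.sin t) • f.e₃
  e₂ := f.e₂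
  pt_mem := f.pt_mem
  tan₁ := by rw [mink_comb_right, f.tan₁, Frame.e₃, mink_cross_left]; ring
  tan₂ := f.tan₂
  unit₁ := by
    have h : mink f.e₁ f.e₃ = 0 := mink_cross_mid _ _ _
    rw [mink_comb_right, mink_comb_left, mink_comb_left, mink_comm f.e₃ f.e₁, f.unit₁, h, f.unit₃]
    linear_combination -(Real.sin_sq_add_cos_sq t)
  unit₂ := f.unit₂
  orth := by
    have h : mink f.e₂ f.e₃ = 0 := mink_cross_right _ _ _
    rw [mink_comb_left, f.orth, mink_comm f.e₃ f.e₂, h]; ring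

/-! ### The action of `SL(2,ℂ)` and spin frames -/

/-- The Hermitian matrix `½ (T+Z, X+iY; X-iY, T-Z)` of a point of Minkowski space. -/
noncomputable def toHerm (p : Mink) : Matrix (Fin 2) (Fin 2) ℂ :=
  !![((p 0 + p 3) / 2 : ℂ), (p 1 + p 2 * Complex.I) / 2;
     (p 1 - p 2 * Complex.I) / 2, (p 0 - p 3) / 2]

/-- The inverse of `toHerm` on Hermitian matrices:
`(a, b+ci; b-ci, d) ↦ (a+d, 2b, 2c, a-d)`. -/
noncomputable def ofHerm (S : Matrix (Fin 2) (Fin 2) ℂ) : Mink :=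
  ![(S 0 0 + S 1 1).re, 2 * (S 0 1).re, 2 * (S 0 1).im, (S 0 0 - S 1 1).re]

/-- The action of `SL(2,ℂ)` on Minkowski space, given on Hermitian matrices by `S ↦ A S A*`. It is
linear, so it is also the derivative of the induced isometry of `ℍ³`. -/
noncomputable def act (A : SL(2, ℂ)) (p : Mink) : Mink :=
  ofHerm ((A : Matrix (Fin 2) (Fin 2) ℂ) * toHerm p * (A : Matrix (Fin 2) (Fin 2) ℂ).conjTranspose)

theorem toHerm_act (A : SL(2, ℂ)) (p : Mink) : toHerm (act A p) =
    (A : Matrix (Fin 2) (Fin 2) ℂ) * toHerm p *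
      (A : Matrix (Fin 2) (Fin 2) ℂ).conjTranspose := by
  ext i j
  fin_cases i <;> fin_cases j <;> apply Complex.ext <;>
    simp [act, toHerm, ofHerm, Matrix.mul_apply, Fin.sum_univ_two] <;> ring

theorem mink_self_eq_det (p : Mink) : ((mink p p : ℝ) : ℂ) = 4 * (toHerm p).det := by
  simp only [mink, toHerm, Matrix.det_fin_two_of]
  push_cast
  linear_combination (-(p 2 : ℂ) ^ 2) * Complex.I_sq

theorem mink_act_self (A : SL(2, ℂ)) (p : Mink) : mink (act A p) (act A p) = mink p p := by
  have h : ((mink (act A p) (act A p) : ℝ) : ℂ) = ((mink p p : ℝ) : ℂ) := by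
    rw [mink_self_eq_det, mink_self_eq_det, toHerm_act]
    simp [Matrix.det_mul, Matrix.det_conjTranspose]
  exact_mod_cast h

theorem act_add (A : SL(2, ℂ)) (p q : Mink) : act A (p + q) = act A p + act A q := by
  ext i
  fin_cases i <;> simp [act, toHerm, ofHerm, Matrix.mul_apply, Fin.sum_univ_two] <;> ring

theorem mink_act (A : SL(2, ℂ)) (p q : Mink) : mink (act A p) (act A q) = mink p q := by
  have h := mink_act_self A (p + q)
  rw [act_add] at h
  have hp := mink_act_self A p
  have hq := mink_act_self A q
  simp only [mink, Pi.add_apply] at *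
  linarith

theorem act_base_mem (A : SL(2, ℂ)) : act A ![1, 0, 0, 0] ∈ H3 := by
  have h1 : mink (act A ![1, 0, 0, 0]) (act A ![1, 0, 0, 0]) = 1 := by
    rw [mink_act]; simp [mink]
  have h2 : 0 ≤ act A ![1, 0, 0, 0] 0 := by
    simp [act, toHerm, ofHerm, Matrix.mul_apply, Fin.sum_univ_two]
    nlinarith [sq_nonneg (A 0 0).re, sq_nonneg (A 0 0).im, sq_nonneg (A 0 1).re,
      sq_nonneg (A 0 1).im, sq_nonneg (A 1 0).re, sq_nonneg (A 1 0).im, sq_nonneg (A 1 1).re,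
      sq_nonneg (A 1 1).im]
  refine ⟨h1, lt_of_le_of_ne h2 fun h => ?_⟩
  simp only [mink, ← h] at h1
  nlinarith [sq_nonneg (act A ![1, 0, 0, 0] 1), sq_nonneg (act A ![1, 0, 0, 0] 2),
    sq_nonneg (act A ![1, 0, 0, 0] 3)]

/-- The total space of the spin double cover of the frame bundle of `ℍ³`. Orientation-preserving
isometries act simply transitively on frames, so the frame bundle is `PSL(2,ℂ)`, and its double
(universal) cover is `SL(2,ℂ)`, with the covering map `Spin.frame`. -/
abbrev Spin : Type := SL(2, ℂ)

/-- The covering projection from spin frames to frames: `A` lies over the image under `A` of the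
base frame `(∂_Z, ∂_Y, -∂_X)` at `(1, 0, 0, 0)`. -/
noncomputable def Spin.frame (A : Spin) : Frame where
  pt := act A ![1, 0, 0, 0]
  e₁ := act A ![0, 0, 0, 1]
  e₂ := act A ![0, 0, 1, 0]
  pt_mem := act_base_mem A
  tan₁ := by rw [mink_act]; simp [mink]
  tan₂ := by rw [mink_act]; simp [mink]
  unit₁ := by rw [mink_act]; simp [mink]
  unit₂ := by rw [mink_act]; simp [mink]
  orth := by rw [mink_act]; simp [mink]

/-- `SpinMove F A t B`: moving the frame continuously along the path of frames `F`, starting at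
time `0` from the spin frame `A`, one arrives at time `t` at the spin frame `B`. In other words,
the lift of `F` to spin frames that starts at `A` passes through `B` at time `t`. -/
def SpinMove (F : ℝ → Frame) (A : Spin) (t : ℝ) (B : Spin) : Prop :=
  ∃ c : ℝ → Spin, Continuous c ∧ (∀ s, Spin.frame (c s) = F s) ∧ c 0 = A ∧ c t = B

/-- `B` is obtained from the spin frame `A` by parallel translation by signed distance `s` along
the oriented geodesic in the direction of the first vector of `A`. -/
def SpinTranslate (A : Spin) (s : ℝ) (B : Spin) : Prop := SpinMove (Spin.frame A).translate A s B

/-- `B` is obtained from the spin frame `A` by rotation by angle `t` about its first vector. -/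
def SpinRotate₁ (A : Spin) (t : ℝ) (B : Spin) : Prop := SpinMove (Spin.frame A).rotate₁ A t B

/-- `B` is obtained from the spin frame `A` by rotation by angle `t` about its second vector. -/
def SpinRotate₂ (A : Spin) (t : ℝ) (B : Spin) : Prop := SpinMove (Spin.frame A).rotate₂ A t B

/-- `d = ρ + iθ` is a complex distance from the spin frame `A` to the spin frame `B`: both are
adapted to a common oriented geodesic (their first vectors are positively tangent to it), and
translation along it by signed distance `ρ` followed by rotation about it by angle `θ` takes `A`
to `B`. Such `d` is meant modulo `4πi`. -/
def IsComplexDistance (A B : Spin) (d : ℂ) : Prop :=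
  ∃ C : Spin, SpinTranslate A d.re C ∧ SpinRotate₁ C d.im B

/-! ### Horospheres -/

/-- A horosphere in the hyperboloid model: a non-empty intersection of `ℍ³` with an affine 3-plane
whose Minkowski normal is lightlike. The normal may be taken in the positive light cone. -/
structure Horosphere where
  carrier : Set Mink
  nonempty : carrier.Nonempty
  exists_plane : ∃ n ∈ lightCone, ∃ c : ℝ, carrier = {x ∈ H3 | mink x n = c}

namespace Horosphere

/-- A vector of the positive light cone on the ray that is the centre of the horosphere. Only the
ray is significant. -/
noncomputable def centre (h : Horosphere) : Mink := h.exists_plane.choose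

theorem centre_mem (h : Horosphere) : h.centre ∈ lightCone := h.exists_plane.choose_spec.1

theorem carrier_eq (h : Horosphere) : ∃ c : ℝ, h.carrier = {x ∈ H3 | mink x h.centre = c} :=
  h.exists_plane.choose_spec.2

theorem mem_H3 (h : Horosphere) (q : h.carrier) : (q : Mink) ∈ H3 := by
  obtain ⟨c, hc⟩ := h.carrier_eq
  exact (hc.subset q.2).1

end Horosphere

/-- The unit tangent vector at `q` pointing along the geodesic ray from `q` to the ideal point
given by the ray of `p`. It does not change if `p` is scaled. -/
noncomputable def towards (q p : Mink) : Mink := (mink q p)⁻¹ • p + (-1 : ℝ) • q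

theorem mink_pos {q p : Mink} (hq : q ∈ H3) (hp : p ∈ lightCone) : 0 < mink q p := by
  obtain ⟨h1, h0⟩ := hq
  obtain ⟨g1, g0⟩ := hp
  simp only [mink] at *
  have cs : (q 1 * p 1 + q 2 * p 2 + q 3 * p 3) ^ 2 ≤
      (q 1 ^ 2 + q 2 ^ 2 + q 3 ^ 2) * (p 1 ^ 2 + p 2 ^ 2 + p 3 ^ 2) := by
    nlinarith [sq_nonneg (q 1 * p 2 - q 2 * p 1), sq_nonneg (q 1 * p 3 - q 3 * p 1),
      sq_nonneg (q 2 * p 3 - q 3 * p 2)]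
  have e1 : q 1 ^ 2 + q 2 ^ 2 + q 3 ^ 2 = q 0 ^ 2 - 1 := by linarith
  have e2 : p 1 ^ 2 + p 2 ^ 2 + p 3 ^ 2 = p 0 ^ 2 := by linarith
  rw [e1, e2] at cs
  have hlt : |q 1 * p 1 + q 2 * p 2 + q 3 * p 3| < q 0 * p 0 := by
    apply abs_lt_of_sq_lt_sq _ (by positivity)
    nlinarith [pow_pos g0 2]
  have := (abs_lt.mp hlt).2
  linarith

theorem mink_towards_left {q p : Mink} (hq : q ∈ H3) (hp : p ∈ lightCone) :
    mink q (towards q p) = 0 := by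
  have h := (mink_pos hq hp).ne'
  rw [towards, mink_comb_right, hq.1]
  field_simp
  norm_num

theorem mink_towards_self {q p : Mink} (hq : q ∈ H3) (hp : p ∈ lightCone) :
    mink (towards q p) (towards q p) = -1 := by
  have h := (mink_pos hq hp).ne'
  rw [towards, mink_comb_right, mink_comb_left, mink_comb_left, hq.1, hp.1, mink_comm p q]
  field_simp
  norm_num

/-- An element of `SL(2,ℂ)` of trace `±2`. -/
def IsParabolic (A : SL(2, ℂ)) : Prop :=
  (A : Matrix (Fin 2) (Fin 2) ℂ).trace = 2 ∨ (A : Matrix (Fin 2) (Fin 2) ℂ).trace = -2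

/-- A unit parallel vector field on a horosphere: a field of unit vectors tangent to the
horosphere, invariant under the parabolic isometries that preserve the horosphere. -/
structure ParallelField (h : Horosphere) where
  V : h.carrier → Mink
  tangent : ∀ q : h.carrier, mink q (V q) = 0 ∧ mink h.centre (V q) = 0
  unit : ∀ q : h.carrier, mink (V q) (V q) = -1
  parallel : ∀ A : SL(2, ℂ), IsParabolic A → act A '' h.carrier = h.carrier →
    ∀ q q' : h.carrier, (q' : Mink) = act A q → V q' = act A (V q)

/-- The outward frame field `(N_out, V, N_out × V)`, where `N_out` is the unit normal of the
horosphere towards its centre. -/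
noncomputable def outFrame (h : Horosphere) (𝒱 : ParallelField h) (q : h.carrier) : Frame where
  pt := q
  e₁ := towards q h.centre
  e₂ := 𝒱.V q
  pt_mem := h.mem_H3 q
  tan₁ := mink_towards_left (h.mem_H3 q) h.centre_mem
  tan₂ := (𝒱.tangent q).1
  unit₁ := mink_towards_self (h.mem_H3 q) h.centre_mem
  unit₂ := 𝒱.unit q
  orth := by rw [towards, mink_comb_left, (𝒱.tangent q).1, (𝒱.tangent q).2]; ring

/-- The inward frame field `(N_in, V, N_in × V)`, where `N_in = -N_out` is the unit normal of the
horosphere pointing away from its centre. -/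
noncomputable def inFrame (h : Horosphere) (𝒱 : ParallelField h) (q : h.carrier) : Frame where
  pt := q
  e₁ := -towards q h.centre
  e₂ := 𝒱.V q
  pt_mem := h.mem_H3 q
  tan₁ := by
    have := (outFrame h 𝒱 q).tan₁
    simp only [outFrame, mink, Pi.neg_apply] at *; linarith
  tan₂ := (𝒱.tangent q).1
  unit₁ := by
    have := (outFrame h 𝒱 q).unit₁
    simp only [outFrame, mink, Pi.neg_apply] at *; linarith
  unit₂ := 𝒱.unit q
  orth := by
    have := (outFrame h 𝒱 q).orth
    simp only [outFrame, mink, Pi.neg_apply] at *; linarith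

/-- A spin-decorated horosphere: a horosphere with continuous lifts `Win`, `Wout` to spin frames of
the inward and outward frame fields of a unit parallel vector field `𝒱`, each associated to the
other: `Win` is `Wout` rotated by `π` about `𝒱`, and `Wout` is `Win` rotated by `-π` about `𝒱`. -/
structure SpinDecoratedHorosphere where
  h : Horosphere
  𝒱 : ParallelField h
  Win : h.carrier → Spin
  Wout : h.carrier → Spin
  continuous_Win : Continuous Win
  continuous_Wout : Continuous Wout
  frame_Win : ∀ q, Spin.frame (Win q) = inFrame h 𝒱 q
  frame_Wout : ∀ q, Spin.frame (Wout q) = outFrame h 𝒱 q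
  associated_in : ∀ q, SpinRotate₂ (Wout q) Real.pi (Win q)
  associated_out : ∀ q, SpinRotate₂ (Win q) (-Real.pi) (Wout q)

/-- The geodesic of `ℍ³` whose two ends are the rays of `p` and `p'`. -/
def geodesic (p p' : Mink) : Set Mink := H3 ∩ {x | ∃ a b : ℝ, x = a • p + b • p'}

/-- `z` is the complex lambda length from the spin-decorated horosphere `D₁` to `D₂`. If the
centres coincide, this means `z = 0`. Otherwise, let `q₁` and `q₂` be the points where the geodesic
between the centres meets the two horospheres; then `z = exp (d / 2)` where `d` is the complex
distance from the inward spin frame of `D₁` at `q₁` to the outward spin frame of `D₂` at `q₂`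
(both are adapted to the geodesic oriented from the first centre to the second). -/
def IsLambdaLength (D₁ D₂ : SpinDecoratedHorosphere) (z : ℂ) : Prop :=
  (SameRay ℝ D₁.h.centre D₂.h.centre ∧ z = 0) ∨
  (¬ SameRay ℝ D₁.h.centre D₂.h.centre ∧
    ∃ (q₁ : D₁.h.carrier) (q₂ : D₂.h.carrier) (d : ℂ),
      (q₁ : Mink) ∈ geodesic D₁.h.centre D₂.h.centre ∧
      (q₂ : Mink) ∈ geodesic D₁.h.centre D₂.h.centre ∧
      IsComplexDistance (D₁.Win q₁) (D₂.Wout q₂) d ∧ z = Complex.exp (d / 2))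

end SpinHoro

/-! The inward frame of a spin-decorated horosphere at a point `q` is an element of `SL(2,ℂ)` whose
second column `κ` satisfies `κ κ* = q + N^out`, a vector on the ray of the centre. Parabolic
isometries fixing the centre are the conjugates of lower unipotent matrices, so moving along the
horosphere multiplies the inward spin frame on the right by such a matrix and does not change `κ`.
Translating along the first vector of a spin frame by `ρ` and rotating about it by `θ` multiplies it
on the right by `diag (exp (d / 2), exp (-d / 2))` with `d = ρ + iθ`. Comparing the frames at the
two ends of the common geodesic, the complex lambda length is therefore the determinant of the
spinors `κ` and `κ'`, and the Ptolemy equation is the Plücker relation for four vectors in `ℂ²`. -/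

namespace SpinHoro

/-! ### Spinors and null vectors -/

/-- The standard symplectic form on pairs, written `{κ, ω}` for spinors `κ, ω ∈ ℂ²`. -/
def wedge {R : Type*} [CommRing R] (κ ω : Fin 2 → R) : R := κ 0 * ω 1 - κ 1 * ω 0

section Wedge

variable {R : Type*} [CommRing R]

theorem wedge_self (κ : Fin 2 → R) : wedge κ κ = 0 := by
  rw [wedge, mul_comm, sub_self]

theorem wedge_neg_left (κ ω : Fin 2 → R) : wedge (-κ) ω = -wedge κ ω := by
  simp only [wedge, Pi.neg_apply]
  ring

theorem wedge_anticomm (κ ω : Fin 2 → R) : -wedge κ ω = wedge ω κ := by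
  simp only [wedge]
  ring

theorem wedge_mul_wedge (κ : Fin 4 → Fin 2 → R) :
    wedge (κ 0) (κ 2) * wedge (κ 1) (κ 3) =
      wedge (κ 0) (κ 1) * wedge (κ 2) (κ 3) + wedge (κ 0) (κ 3) * wedge (κ 1) (κ 2) := by
  simp only [wedge]
  ring

theorem exists_eq_smul_of_wedge_eq_zero {K : Type*} [Field K] {κ ω : Fin 2 → K} (hκ : κ ≠ 0)
    (h : wedge κ ω = 0) : ∃ μ : K, ω = μ • κ := by
  rw [wedge, sub_eq_zero] at h
  obtain ⟨i, hi⟩ := Function.ne_iff.mp hκ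
  refine ⟨ω i / κ i, funext fun j => ?_⟩
  rw [Pi.smul_apply, smul_eq_mul, div_mul_eq_mul_div, eq_div_iff hi]
  fin_cases i <;> fin_cases j <;> grind

theorem wedge_col (A : SL(2, R)) : wedge (A.1.col 0) (A.1.col 1) = 1 := by
  have det_eq := A.det_coe
  rw [Matrix.det_fin_two] at det_eq
  simp only [wedge, Matrix.col_apply]
  linear_combination det_eq

theorem coe_inv_mul_eq_wedge (A B : SL(2, R)) : (A⁻¹ * B).1 =
    !![wedge (B.1.col 0) (A.1.col 1), wedge (B.1.col 1) (A.1.col 1);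
       wedge (A.1.col 0) (B.1.col 0), wedge (A.1.col 0) (B.1.col 1)] := by
  rw [Matrix.SpecialLinearGroup.coe_mul, Matrix.SpecialLinearGroup.coe_inv,
    Matrix.adjugate_fin_two]
  ext i j
  fin_cases i <;> fin_cases j <;>
    simp [wedge, Matrix.mul_apply, Fin.sum_univ_two] <;> ring

end Wedge

theorem toHerm_ofHerm {S : Matrix (Fin 2) (Fin 2) ℂ} (hS : S.IsHermitian) :
    toHerm (ofHerm S) = S := by
  have h00 := hS.apply 0 0
  have h10 := hS.apply 1 0
  have h11 := hS.apply 1 1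
  ext i j
  fin_cases i <;> fin_cases j <;> simp_all [toHerm, ofHerm, Complex.ext_iff] <;> grind

theorem toHerm_injective : Function.Injective toHerm := by
  have ofHerm_toHerm : Function.LeftInverse ofHerm toHerm := fun p => by
    ext i
    fin_cases i <;> simp [toHerm, ofHerm] <;> ring
  exact ofHerm_toHerm.injective

/-- The null vector `κ κ*` of a spinor `κ`, in Minkowski coordinates. -/
noncomputable def nullVec (κ : Fin 2 → ℂ) : Mink := ofHerm (Matrix.vecMulVec κ (star κ))

theorem toHerm_nullVec (κ : Fin 2 → ℂ) : toHerm (nullVec κ) = Matrix.vecMulVec κ (star κ) :=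
  toHerm_ofHerm (by rw [Matrix.IsHermitian, Matrix.conjTranspose_vecMulVec, star_star])

theorem nullVec_single_zero : nullVec (Pi.single 0 1) = ![1, 0, 0, 1] := by
  ext i
  fin_cases i <;> simp [nullVec, ofHerm, Matrix.vecMulVec_apply]

theorem nullVec_single_one : nullVec (Pi.single 1 1) = ![1, 0, 0, -1] := by
  ext i
  fin_cases i <;> simp [nullVec, ofHerm, Matrix.vecMulVec_apply]

theorem nullVec_smul (μ : ℂ) (κ : Fin 2 → ℂ) : nullVec (μ • κ) = Complex.normSq μ • nullVec κ := by
  ext i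
  fin_cases i <;>
    simp [nullVec, ofHerm, Matrix.vecMulVec_apply, Complex.normSq_apply] <;> ring

theorem mink_nullVec (κ ω : Fin 2 → ℂ) :
    mink (nullVec κ) (nullVec ω) = 2 * Complex.normSq (wedge κ ω) := by
  simp [mink, nullVec, ofHerm, Matrix.vecMulVec_apply, Complex.normSq_apply, wedge]
  ring

theorem mink_nullVec_eq_zero_iff {κ ω : Fin 2 → ℂ} :
    mink (nullVec κ) (nullVec ω) = 0 ↔ wedge κ ω = 0 := by
  rw [mink_nullVec, mul_eq_zero, or_iff_right two_ne_zero, Complex.normSq_eq_zero]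

theorem nullVec_mem_lightCone {κ : Fin 2 → ℂ} (hκ : κ ≠ 0) : nullVec κ ∈ lightCone := by
  have time_eq : nullVec κ 0 = Complex.normSq (κ 0) + Complex.normSq (κ 1) := by
    simp [nullVec, ofHerm, Matrix.vecMulVec_apply, Complex.normSq_apply]
  refine ⟨mink_nullVec_eq_zero_iff.mpr (wedge_self κ), ?_⟩
  obtain ⟨i, hi⟩ := Function.ne_iff.mp hκ
  have hi : 0 < Complex.normSq (κ i) := Complex.normSq_pos.mpr hi
  have h0 := Complex.normSq_nonneg (κ 0)
  have h1 := Complex.normSq_nonneg (κ 1)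
  rw [time_eq]
  fin_cases i
  · exact add_pos_of_pos_of_nonneg hi h1
  · exact add_pos_of_nonneg_of_pos h0 hi

theorem mink_smul_left (r : ℝ) (p q : Mink) : mink (r • p) q = r * mink p q := by
  simpa using mink_comb_left q p 0 r 0

theorem mink_smul_right (r : ℝ) (p q : Mink) : mink p (r • q) = r * mink p q := by
  rw [mink_comm, mink_smul_left, mink_comm]

theorem mink_eq_zero_of_sameRay {p q : Mink} (hp : mink p p = 0) (h : SameRay ℝ p q) :
    mink p q = 0 := by
  rcases h with rfl | rfl | ⟨r, s, -, hs, hrs⟩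
  · simp [mink]
  · simp [mink]
  · have : s * mink p q = 0 := by
      rw [← mink_smul_right, ← hrs, mink_smul_right, hp, mul_zero]
    exact (mul_eq_zero.mp this).resolve_left hs.ne'

theorem sameRay_nullVec_iff {κ ω : Fin 2 → ℂ} :
    SameRay ℝ (nullVec κ) (nullVec ω) ↔ wedge κ ω = 0 := by
  constructor
  · intro h
    have mink_self : mink (nullVec κ) (nullVec κ) = 0 :=
      mink_nullVec_eq_zero_iff.mpr (wedge_self κ)
    exact mink_nullVec_eq_zero_iff.mp (mink_eq_zero_of_sameRay mink_self h)
  · intro h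
    rcases eq_or_ne κ 0 with rfl | hκ
    · have nullVec_zero : nullVec 0 = 0 := by
        rw [← zero_smul ℂ 0, nullVec_smul, map_zero, zero_smul]
      exact nullVec_zero ▸ SameRay.zero_left _
    · obtain ⟨μ, rfl⟩ := exists_eq_smul_of_wedge_eq_zero hκ h
      rw [nullVec_smul]
      exact SameRay.sameRay_nonneg_smul_right _ (Complex.normSq_nonneg μ)

theorem wedge_eq_zero_of_nullVec_eq_smul {κ ω : Fin 2 → ℂ} {p : Mink} (hp : mink p p = 0)
    {r s : ℝ} (hκ : nullVec κ = r • p) (hω : nullVec ω = s • p) : wedge κ ω = 0 := by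
  rw [← mink_nullVec_eq_zero_iff, hκ, hω, mink_smul_left, mink_smul_right, hp, mul_zero, mul_zero]

theorem act_mul (A B : SL(2, ℂ)) (p : Mink) : act (A * B) p = act A (act B p) := by
  apply toHerm_injective
  simp only [toHerm_act, Matrix.SpecialLinearGroup.coe_mul, Matrix.conjTranspose_mul,
    Matrix.mul_assoc]

theorem act_one (p : Mink) : act 1 p = p := by
  apply toHerm_injective
  simp only [toHerm_act, Matrix.SpecialLinearGroup.coe_one, Matrix.conjTranspose_one,
    Matrix.one_mul, Matrix.mul_one]

theorem act_inv_eq_iff {A : SL(2, ℂ)} {p q : Mink} : act A⁻¹ p = q ↔ p = act A q := by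
  constructor
  · rintro rfl
    rw [← act_mul, mul_inv_cancel, act_one]
  · rintro rfl
    rw [← act_mul, inv_mul_cancel, act_one]

theorem act_smul (A : SL(2, ℂ)) (r : ℝ) (p : Mink) : act A (r • p) = r • act A p := by
  ext i
  fin_cases i <;> simp [act, toHerm, ofHerm, Matrix.mul_apply, Fin.sum_univ_two] <;> ring

theorem continuous_act (p : Mink) : Continuous fun A : SL(2, ℂ) => act A p := by
  unfold act ofHerm
  fun_prop

theorem act_nullVec (A : SL(2, ℂ)) (κ : Fin 2 → ℂ) :
    act A (nullVec κ) = nullVec (A.1.mulVec κ) := by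
  apply toHerm_injective
  rw [toHerm_act, toHerm_nullVec, toHerm_nullVec, Matrix.mul_vecMulVec, Matrix.vecMulVec_mul,
    Matrix.star_mulVec]

theorem toHerm_cross (q v w : Mink) : toHerm (cross q v w) =
    (2 * Complex.I) • (toHerm w * (toHerm v).adjugate * toHerm q -
      toHerm q * (toHerm v).adjugate * toHerm w) := by
  rw [cross_apply]
  ext i j
  fin_cases i <;> fin_cases j <;> apply Complex.ext <;>
    simp [toHerm, Matrix.adjugate_fin_two] <;> ring

theorem adjugate_toHerm_act (A : SL(2, ℂ)) (p : Mink) : (toHerm (act A p)).adjugate =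
    A.1.conjTranspose.adjugate * (toHerm p).adjugate * A.1.adjugate := by
  rw [toHerm_act, Matrix.adjugate_mul_distrib, Matrix.adjugate_mul_distrib, Matrix.mul_assoc]

theorem act_cross (A : SL(2, ℂ)) (q v w : Mink) :
    act A (cross q v w) = cross (act A q) (act A v) (act A w) := by
  have hA : A.1.adjugate * A.1 = 1 := by rw [Matrix.adjugate_mul, A.det_coe, one_smul]
  have hA' : A.1.conjTranspose * A.1.conjTranspose.adjugate = 1 := by
    rw [Matrix.mul_adjugate, Matrix.det_conjTranspose, A.det_coe, star_one, one_smul]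
  have act_triple (x y z : Mink) :
      toHerm (act A x) * (toHerm (act A y)).adjugate * toHerm (act A z) =
        A.1 * (toHerm x * (toHerm y).adjugate * toHerm z) * A.1.conjTranspose := by
    rw [adjugate_toHerm_act, toHerm_act, toHerm_act]
    simp only [Matrix.mul_assoc]
    rw [← Matrix.mul_assoc A.1.conjTranspose, hA', Matrix.one_mul,
      ← Matrix.mul_assoc A.1.adjugate, hA, Matrix.one_mul]
  apply toHerm_injective
  rw [toHerm_act, toHerm_cross, toHerm_cross, act_triple, act_triple, Matrix.mul_smul,
    Matrix.smul_mul, Matrix.mul_sub, Matrix.sub_mul]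

/-! ### Spin frames and their rigid motions -/

theorem mem_H3_of_mink_pos {y p : Mink} (hy : mink y y = 1) (hp : p ∈ lightCone)
    (h : 0 < mink y p) : y ∈ H3 := by
  refine ⟨hy, ?_⟩
  by_contra! h0
  rcases h0.lt_or_eq with h0 | h0
  · have : 0 < mink (-y) p := mink_pos ⟨by simpa [mink] using hy, by simpa using h0⟩ hp
    simp only [mink, Pi.neg_apply] at this h
    linarith
  · simp only [mink, h0] at hy
    nlinarith [sq_nonneg (y 1), sq_nonneg (y 2), sq_nonneg (y 3)]

theorem col_ne_zero (A : SL(2, ℂ)) : A.1.col 0 ≠ 0 := fun h => by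
  have := wedge_col A
  rw [h, wedge, Pi.zero_apply, Pi.zero_apply, zero_mul, zero_mul, sub_zero] at this
  exact zero_ne_one this

theorem nullVec_col (A : SL(2, ℂ)) (i : Fin 2) :
    nullVec (A.1.col i) = act A (nullVec (Pi.single i 1)) := by
  rw [act_nullVec, Matrix.mulVec_single_one]

theorem act_mem_H3 (A : SL(2, ℂ)) {q : Mink} (hq : q ∈ H3) : act A q ∈ H3 := by
  refine mem_H3_of_mink_pos (by rw [mink_act, hq.1]) (nullVec_mem_lightCone (col_ne_zero A)) ?_
  rw [nullVec_col, mink_act]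
  exact mink_pos hq (nullVec_mem_lightCone (by simp))

/-- Orientation-preserving isometries of `ℍ³` act on frames through their derivatives. -/
noncomputable instance : MulAction SL(2, ℂ) Frame where
  smul A f :=
    { pt := act A f.pt
      e₁ := act A f.e₁
      e₂ := act A f.e₂
      pt_mem := act_mem_H3 A f.pt_mem
      tan₁ := by rw [mink_act, f.tan₁]
      tan₂ := by rw [mink_act, f.tan₂]
      unit₁ := by rw [mink_act, f.unit₁]
      unit₂ := by rw [mink_act, f.unit₂]
      orth := by rw [mink_act, f.orth] }
  one_smul _ := Frame.ext (act_one _) (act_one _) (act_one _)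
  mul_smul A B _ := Frame.ext (act_mul A B _) (act_mul A B _) (act_mul A B _)

namespace Frame

variable (A : SL(2, ℂ)) (f : Frame)

theorem smul_pt : (A • f).pt = act A f.pt := rfl

theorem smul_e₁ : (A • f).e₁ = act A f.e₁ := rfl

theorem smul_e₂ : (A • f).e₂ = act A f.e₂ := rfl

theorem smul_e₃ : (A • f).e₃ = act A f.e₃ := (act_cross A _ _ _).symm

theorem smul_translate (s : ℝ) : A • f.translate s = (A • f).translate s := by
  apply Frame.ext <;> simp only [translate, smul_pt, smul_e₁, smul_e₂, act_add, act_smul]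

theorem smul_rotate₁ (t : ℝ) : A • f.rotate₁ t = (A • f).rotate₁ t := by
  apply Frame.ext <;>
    simp only [rotate₁, smul_pt, smul_e₁, smul_e₂, smul_e₃, act_add, act_smul]

theorem smul_rotate₂ (t : ℝ) : A • f.rotate₂ t = (A • f).rotate₂ t := by
  apply Frame.ext <;>
    simp only [rotate₂, smul_pt, smul_e₁, smul_e₂, smul_e₃, act_add, act_smul]

end Frame

theorem Spin.frame_mul (A B : Spin) : Spin.frame (A * B) = A • Spin.frame B :=
  Frame.ext (act_mul A B _) (act_mul A B _) (act_mul A B _)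

theorem Spin.frame_one_e₃ : (Spin.frame 1).e₃ = ![0, -1, 0, 0] := by
  simp [Frame.e₃, Spin.frame, act_one, cross_apply]

theorem nullVec_col_zero (A : Spin) :
    nullVec (A.1.col 0) = (Spin.frame A).pt + (Spin.frame A).e₁ := by
  rw [nullVec_col, nullVec_single_zero, Spin.frame, ← act_add]
  simp

theorem nullVec_col_one (A : Spin) :
    nullVec (A.1.col 1) = (Spin.frame A).pt - (Spin.frame A).e₁ := by
  rw [nullVec_col, nullVec_single_one, Spin.frame, sub_eq_add_neg,
    ← neg_one_smul ℝ (act A _), ← act_smul, ← act_add]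
  simp

theorem conjTranspose_mul_self_eq_one {C : SL(2, ℂ)} (h : act C ![1, 0, 0, 0] = ![1, 0, 0, 0]) :
    C.1.conjTranspose * C.1 = 1 := by
  have toHerm_T : toHerm ![1, 0, 0, 0] = (1 / 2 : ℂ) • 1 := by
    ext i j
    fin_cases i <;> fin_cases j <;> simp [toHerm]
  rw [mul_eq_one_comm]
  have := toHerm_act C ![1, 0, 0, 0]
  rw [h, toHerm_T, Matrix.mul_smul, Matrix.smul_mul, Matrix.mul_one] at this
  exact (smul_right_injective _ (by norm_num) this).symm

theorem mul_toHerm_comm {C : SL(2, ℂ)} (hC : C.1.conjTranspose * C.1 = 1) {p : Mink}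
    (hp : act C p = p) : C.1 * toHerm p = toHerm p * C.1 := by
  have := congrArg (· * C.1) (toHerm_act C p)
  simp only [hp, Matrix.mul_assoc, hC, Matrix.mul_one] at this
  exact this.symm

theorem Spin.eq_one_or_eq_neg_one_of_frame_eq {C : Spin} (h : Spin.frame C = Spin.frame 1) :
    C = 1 ∨ C = -1 := by
  have act_T : act C ![1, 0, 0, 0] = ![1, 0, 0, 0] := (congrArg Frame.pt h).trans (act_one _)
  have act_Z : act C ![0, 0, 0, 1] = ![0, 0, 0, 1] := (congrArg Frame.e₁ h).trans (act_one _)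
  have act_Y : act C ![0, 0, 1, 0] = ![0, 0, 1, 0] := (congrArg Frame.e₂ h).trans (act_one _)
  -- Fixing the base point means that `C` is unitary; it then commutes with the Pauli matrices.
  have unitary := conjTranspose_mul_self_eq_one act_T
  have comm_Z := mul_toHerm_comm unitary act_Z
  have comm_Y := mul_toHerm_comm unitary act_Y
  have C01 : C 0 1 = 0 := by
    have entry : C 0 1 * (-1 / 2) = 2⁻¹ * C 0 1 := by
      simpa [toHerm, Matrix.mul_apply] using congrFun₂ comm_Z 0 1
    linear_combination -entry
  have C10 : C 1 0 = 0 := by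
    have entry : C 1 0 * 2⁻¹ = -1 / 2 * C 1 0 := by
      simpa [toHerm, Matrix.mul_apply] using congrFun₂ comm_Z 1 0
    linear_combination entry
  have C11 : C 1 1 = C 0 0 := by
    have entry : C 0 0 * (Complex.I / 2) = Complex.I / 2 * C 1 1 := by
      simpa [toHerm, Matrix.mul_apply] using congrFun₂ comm_Y 0 1
    exact mul_left_cancel₀ (div_ne_zero Complex.I_ne_zero two_ne_zero)
      (entry.symm.trans (mul_comm _ _))
  have sq_eq_one : C 0 0 * C 0 0 = 1 := by
    have := C.det_coe
    rwa [Matrix.det_fin_two, C01, C11, zero_mul, sub_zero] at this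
  rcases mul_self_eq_one_iff.mp sq_eq_one with C00 | C00
  · left
    ext i j
    fin_cases i <;> fin_cases j <;> simp [C01, C10, C11, C00]
  · right
    ext i j
    fin_cases i <;> fin_cases j <;> simp [C01, C10, C11, C00]

theorem Spin.lift_unique {X : Type*} [TopologicalSpace X] [PreconnectedSpace X] {c c' : X → Spin}
    (hc : Continuous c) (hc' : Continuous c') (h : ∀ x, Spin.frame (c x) = Spin.frame (c' x))
    {x₀ : X} (h₀ : c x₀ = c' x₀) : c = c' := by
  have mem_pair (x : X) : (c x)⁻¹ * c' x ∈ ({1, -1} : Set Spin) := by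
    apply Spin.eq_one_or_eq_neg_one_of_frame_eq
    rw [Spin.frame_mul, ← h, ← Spin.frame_mul, inv_mul_cancel]
  funext x
  have := isPreconnected_univ.constant_of_mapsTo (Set.toFinite {1, -1}).isDiscrete
    (hc.inv.mul hc').continuousOn (fun x _ => mem_pair x) (Set.mem_univ x₀) (Set.mem_univ x)
  rwa [Pi.mul_apply, Pi.mul_apply, Pi.inv_apply, Pi.inv_apply, h₀, inv_mul_cancel, eq_comm,
    inv_mul_eq_one] at this

theorem SpinMove.iff_of_lift {F : ℝ → Frame} {c : ℝ → Spin} (hc : Continuous c)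
    (hF : ∀ s, Spin.frame (c s) = F s) {t : ℝ} {B : Spin} : SpinMove F (c 0) t B ↔ B = c t := by
  constructor
  · rintro ⟨c', hc', hF', h0, rfl⟩
    rw [Spin.lift_unique hc' hc (fun s => (hF' s).trans (hF s).symm) h0]
  · rintro rfl
    exact ⟨c, hc, hF, rfl, rfl⟩

/-- The diagonal matrix with entries `exp (d / 2)` and `exp (-d / 2)`. -/
noncomputable def diagExp (d : ℂ) : SL(2, ℂ) :=
  ⟨!![Complex.exp (d / 2), 0; 0, Complex.exp (-(d / 2))], by
    rw [Matrix.det_fin_two_of, ← Complex.exp_add, add_neg_cancel, Complex.exp_zero, zero_mul,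
      sub_zero]⟩

theorem continuous_diagExp : Continuous diagExp := by
  refine Continuous.subtype_mk (continuous_matrix fun i j => ?_) _
  fin_cases i <;> fin_cases j <;> dsimp <;> fun_prop

theorem diagExp_zero : diagExp 0 = 1 := by
  ext i j
  fin_cases i <;> fin_cases j <;> simp [diagExp]

theorem diagExp_add (d d' : ℂ) : diagExp (d + d') = diagExp d * diagExp d' := by
  apply Subtype.ext
  rw [Matrix.SpecialLinearGroup.coe_mul]
  simp [diagExp, add_div, Complex.exp_add, mul_comm]

theorem eq_diagExp_iff {C : SL(2, ℂ)} {d : ℂ} :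
    C = diagExp d ↔ C 1 0 = 0 ∧ C 0 1 = 0 ∧ C 0 0 = Complex.exp (d / 2) := by
  refine ⟨fun h => by simp [h, diagExp], fun ⟨h10, h01, h00⟩ => ?_⟩
  have h11 : C 1 1 = Complex.exp (-(d / 2)) := by
    have := C.det_coe
    rw [Matrix.det_fin_two, h01, zero_mul, sub_zero, h00] at this
    rw [Complex.exp_neg]
    exact eq_inv_of_mul_eq_one_right this
  ext i j
  fin_cases i <;> fin_cases j <;> simp [diagExp, h00, h01, h10, h11]

theorem act_diagExp (d : ℂ) (p : Mink) : act (diagExp d) p =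
    ![Real.cosh d.re * p 0 + Real.sinh d.re * p 3,
      Real.cos d.im * p 1 - Real.sin d.im * p 2,
      Real.sin d.im * p 1 + Real.cos d.im * p 2,
      Real.sinh d.re * p 0 + Real.cosh d.re * p 3] := by
  obtain ⟨z, rfl⟩ : ∃ z, d = 2 * z := ⟨d / 2, by ring⟩
  have exp_two_mul : Real.exp (2 * z.re) = Real.exp z.re ^ 2 := by
    rw [← Real.exp_nat_mul, Nat.cast_ofNat]
  have exp_neg_two_mul : Real.exp (-(2 * z.re)) = Real.exp (-z.re) ^ 2 := by
    rw [← Real.exp_nat_mul, Nat.cast_ofNat, mul_neg]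
  have exp_mul_exp_neg : Real.exp z.re * Real.exp (-z.re) = 1 := by
    rw [← Real.exp_add, add_neg_cancel, Real.exp_zero]
  have cos_sq_add_sin_sq := Real.cos_sq_add_sin_sq z.im
  ext i
  fin_cases i <;>
    simp [act, toHerm, ofHerm, diagExp, Matrix.mul_apply, Complex.exp_re, Complex.exp_im,
      Real.cosh_eq, Real.sinh_eq, Real.cos_two_mul, Real.sin_two_mul] <;> grind

/-- The lift to `SL(2,ℂ)` of the rotation by angle `t` about the `Y` axis. -/
noncomputable def rotY (t : ℝ) : SL(2, ℂ) :=
  ⟨!![(Real.cos (t / 2) : ℂ), -(Real.sin (t / 2) : ℂ);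
      (Real.sin (t / 2) : ℂ), (Real.cos (t / 2) : ℂ)], by
    rw [Matrix.det_fin_two_of]
    norm_cast
    linear_combination Real.cos_sq_add_sin_sq (t / 2)⟩

theorem continuous_rotY : Continuous rotY := by
  refine Continuous.subtype_mk (continuous_matrix fun i j => ?_) _
  fin_cases i <;> fin_cases j <;> dsimp <;> fun_prop

theorem rotY_zero : rotY 0 = 1 := by
  ext i j
  fin_cases i <;> fin_cases j <;> simp [rotY]

theorem act_rotY (t : ℝ) (p : Mink) : act (rotY t) p =
    ![p 0, Real.cos t * p 1 + Real.sin t * p 3, p 2, Real.cos t * p 3 - Real.sin t * p 1] := by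
  obtain ⟨z, rfl⟩ : ∃ z, t = 2 * z := ⟨t / 2, by ring⟩
  have cos_sq_add_sin_sq := Real.cos_sq_add_sin_sq z
  ext i
  fin_cases i <;>
    simp [act, toHerm, ofHerm, rotY, Matrix.mul_apply, Real.cos_two_mul, Real.sin_two_mul,
      -Complex.ofReal_cos, -Complex.ofReal_sin] <;> grind

theorem Spin.frame_mul_diagExp_ofReal (A : Spin) (s : ℝ) :
    Spin.frame (A * diagExp s) = (Spin.frame A).translate s := by
  have base : Spin.frame (diagExp s) = (Spin.frame 1).translate s := by
    apply Frame.ext <;> simp [Spin.frame, Frame.translate, act_diagExp, act_one]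
  rw [Spin.frame_mul, base, Frame.smul_translate, ← Spin.frame_mul, mul_one]

theorem Spin.frame_mul_diagExp_mul_I (A : Spin) (t : ℝ) :
    Spin.frame (A * diagExp (t * Complex.I)) = (Spin.frame A).rotate₁ t := by
  have base : Spin.frame (diagExp (t * Complex.I)) = (Spin.frame 1).rotate₁ t := by
    apply Frame.ext <;>
      simp [Frame.rotate₁, Spin.frame_one_e₃] <;> simp [Spin.frame, act_diagExp, act_one]
  rw [Spin.frame_mul, base, Frame.smul_rotate₁, ← Spin.frame_mul, mul_one]

theorem Spin.frame_mul_rotY (A : Spin) (t : ℝ) :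
    Spin.frame (A * rotY t) = (Spin.frame A).rotate₂ t := by
  have base : Spin.frame (rotY t) = (Spin.frame 1).rotate₂ t := by
    apply Frame.ext <;>
      simp [Frame.rotate₂, Spin.frame_one_e₃] <;> simp [Spin.frame, act_rotY, act_one]
  rw [Spin.frame_mul, base, Frame.smul_rotate₂, ← Spin.frame_mul, mul_one]

theorem spinTranslate_iff {A B : Spin} {s : ℝ} : SpinTranslate A s B ↔ B = A * diagExp s := by
  have := SpinMove.iff_of_lift (c := fun s : ℝ => A * diagExp s) (t := s) (B := B)
    (continuous_const.mul (continuous_diagExp.comp Complex.continuous_ofReal))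
    (Spin.frame_mul_diagExp_ofReal A)
  simpa [diagExp_zero, SpinTranslate] using this

theorem spinRotate₁_iff {A B : Spin} {t : ℝ} :
    SpinRotate₁ A t B ↔ B = A * diagExp (t * Complex.I) := by
  have := SpinMove.iff_of_lift (c := fun t : ℝ => A * diagExp (t * Complex.I)) (t := t) (B := B)
    (continuous_const.mul (continuous_diagExp.comp (by fun_prop)))
    (Spin.frame_mul_diagExp_mul_I A)
  simpa [diagExp_zero, SpinRotate₁] using this

theorem spinRotate₂_iff {A B : Spin} {t : ℝ} : SpinRotate₂ A t B ↔ B = A * rotY t := by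
  have := SpinMove.iff_of_lift (c := fun t : ℝ => A * rotY t) (t := t) (B := B)
    (continuous_const.mul continuous_rotY) (Spin.frame_mul_rotY A)
  simpa [rotY_zero, SpinRotate₂] using this

theorem isComplexDistance_iff {A B : Spin} {d : ℂ} :
    IsComplexDistance A B d ↔ B = A * diagExp d := by
  simp only [IsComplexDistance, spinTranslate_iff, spinRotate₁_iff, exists_eq_left, mul_assoc,
    ← diagExp_add, Complex.re_add_im]

theorem isComplexDistance_iff_wedge {A B : Spin} {d : ℂ} : IsComplexDistance A B d ↔
    wedge (A.1.col 0) (B.1.col 0) = 0 ∧ wedge (B.1.col 1) (A.1.col 1) = 0 ∧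
      wedge (B.1.col 0) (A.1.col 1) = Complex.exp (d / 2) := by
  rw [isComplexDistance_iff, ← inv_mul_eq_iff_eq_mul, eq_diagExp_iff, coe_inv_mul_eq_wedge]
  simp

/-! ### Horospheres and their spinors -/

/-- The parabolic matrix `(1, 0; s, 1)`. -/
noncomputable def lowerUnip (s : ℂ) : SL(2, ℂ) :=
  ⟨!![1, 0; s, 1], by rw [Matrix.det_fin_two_of, mul_one, zero_mul, sub_zero]⟩

theorem continuous_lowerUnip : Continuous lowerUnip := by
  refine Continuous.subtype_mk (continuous_matrix fun i j => ?_) _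
  fin_cases i <;> fin_cases j <;> dsimp <;> fun_prop

theorem lowerUnip_zero : lowerUnip 0 = 1 := by
  ext i j
  fin_cases i <;> fin_cases j <;> simp [lowerUnip]

theorem col_one_mul_lowerUnip (A : SL(2, ℂ)) (s : ℂ) :
    (A * lowerUnip s).1.col 1 = A.1.col 1 := by
  ext i
  rw [Matrix.SpecialLinearGroup.coe_mul]
  simp [lowerUnip, Matrix.mul_apply]

theorem isParabolic_conj_lowerUnip (A : SL(2, ℂ)) (s : ℂ) :
    IsParabolic (A * lowerUnip s * A⁻¹) := by
  left
  rw [Matrix.SpecialLinearGroup.coe_mul, Matrix.trace_mul_comm,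
    ← Matrix.SpecialLinearGroup.coe_mul, inv_mul_cancel_left]
  simp [lowerUnip, Matrix.trace_fin_two, one_add_one_eq_two]

theorem act_lowerUnip_base {x : Mink} (hx : mink x x = 1) (hn : mink x ![1, 0, 0, -1] = 1) :
    act (lowerUnip (x 1 - x 2 * Complex.I)) ![1, 0, 0, 0] = x := by
  have time_add : x 0 + x 3 = 1 := by simpa [mink] using hn
  rw [mink] at hx
  ext i
  fin_cases i <;>
    simp [act, toHerm, ofHerm, lowerUnip, Matrix.mul_apply] <;> grind

theorem add_towards (q p : Mink) : q + towards q p = (mink q p)⁻¹ • p := by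
  rw [towards]
  module

theorem act_towards (A : SL(2, ℂ)) (q p : Mink) :
    act A (towards q p) = towards (act A q) (act A p) := by
  rw [towards, towards, act_add, act_smul, act_smul, mink_act]

theorem geodesic_comm (p p' : Mink) : geodesic p p' = geodesic p' p := by
  ext x
  simp only [geodesic, Set.mem_inter_iff, Set.mem_ofPred_eq, add_comm (_ • p)]
  rw [exists_comm]

theorem towards_eq_neg_towards {p p' q : Mink} (hp : mink p p = 0) (hp' : mink p' p' = 0)
    (hq : q ∈ geodesic p p') : towards q p' = -towards q p := by
  obtain ⟨⟨hqq, -⟩, a, b, rfl⟩ := hq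
  set m := mink p p'
  have mink_left : mink (a • p + b • p') p = b * m := by
    rw [mink_comb_left, hp, mink_comm p', mul_zero, zero_add]
  have mink_right : mink (a • p + b • p') p' = a * m := by
    rw [mink_comb_left, hp', mul_zero, add_zero]
  rw [mink_comb_right, mink_left, mink_right] at hqq
  have inv_left : (b * m)⁻¹ = 2 * a := inv_eq_of_mul_eq_one_right (by linarith)
  have inv_right : (a * m)⁻¹ = 2 * b := inv_eq_of_mul_eq_one_right (by linarith)
  rw [towards, towards, mink_left, mink_right, inv_left, inv_right]
  module

namespace Horosphere

variable (h : Horosphere)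

theorem mink_centre_eq (q q' : h.carrier) : mink q h.centre = mink q' h.centre := by
  obtain ⟨c, hc⟩ := h.carrier_eq
  exact (hc.subset q.2).2.trans (hc.subset q'.2).2.symm

theorem mink_centre_pos (q : h.carrier) : 0 < mink q h.centre :=
  mink_pos (h.mem_H3 q) h.centre_mem

theorem mem_carrier {x : Mink} (q : h.carrier) (hx : mink x x = 1)
    (hq : mink x h.centre = mink q h.centre) : x ∈ h.carrier := by
  obtain ⟨c, hc⟩ := h.carrier_eq
  rw [hc]
  exact ⟨mem_H3_of_mink_pos hx h.centre_mem (hq ▸ h.mink_centre_pos q),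
    hq.trans (hc.subset q.2).2⟩

theorem exists_mem_geodesic {p : Mink} (hp : mink p p = 0) (hcp : 0 < mink h.centre p) :
    ∃ q : h.carrier, (q : Mink) ∈ geodesic h.centre p := by
  obtain ⟨q₀⟩ := h.nonempty.to_subtype
  set c := mink q₀ h.centre
  have hc : 0 < c := h.mink_centre_pos q₀
  let x := (2 * c)⁻¹ • h.centre + (c / mink h.centre p) • p
  have mink_x_centre : mink x h.centre = c := by
    rw [mink_comb_left, h.centre_mem.1, mink_comm p, mul_zero, zero_add,
      div_mul_cancel₀ _ hcp.ne']
  have mink_x_x : mink x x = 1 := by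
    rw [mink_comb_right, mink_x_centre, mink_comb_left, hp]
    field_simp
    ring
  have hx := h.mem_carrier q₀ mink_x_x mink_x_centre
  exact ⟨⟨x, hx⟩, h.mem_H3 ⟨x, hx⟩, _, _, rfl⟩

variable {h} {P : SL(2, ℂ)}

theorem act_mem_carrier (hP : act P h.centre = h.centre) (q : h.carrier) :
    act P q ∈ h.carrier := by
  apply h.mem_carrier q
  · rw [mink_act, (h.mem_H3 q).1]
  · rw [← mink_act P q h.centre, hP]

theorem act_image_carrier (hP : act P h.centre = h.centre) :
    act P '' h.carrier = h.carrier := by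
  apply subset_antisymm
  · rintro _ ⟨q, hq, rfl⟩
    exact act_mem_carrier hP ⟨q, hq⟩
  · intro q hq
    have hP' : act P⁻¹ h.centre = h.centre := act_inv_eq_iff.mpr hP.symm
    exact ⟨act P⁻¹ q, act_mem_carrier hP' ⟨q, hq⟩, (act_inv_eq_iff.mp rfl).symm⟩

theorem inFrame_act (𝒱 : ParallelField h) (hP : IsParabolic P)
    (hPc : act P h.centre = h.centre) (q : h.carrier) :
    inFrame h 𝒱 ⟨act P q, act_mem_carrier hPc q⟩ = P • inFrame h 𝒱 q := by
  apply Frame.ext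
  · rfl
  · have act_neg (v : Mink) : act P (-v) = -act P v := by
      rw [← neg_one_smul ℝ, act_smul, neg_one_smul]
    change -towards (act P q) h.centre = act P (-towards q h.centre)
    rw [act_neg, act_towards, hPc]
  · exact 𝒱.parallel P hP (act_image_carrier hPc) q _ rfl

end Horosphere

namespace SpinDecoratedHorosphere

variable (D : SpinDecoratedHorosphere)

theorem nullVec_Win_zero (q : D.h.carrier) :
    nullVec ((D.Win q).1.col 0) = q - towards q D.h.centre := by
  rw [nullVec_col_zero, D.frame_Win, sub_eq_add_neg, inFrame]

theorem nullVec_Win_one (q : D.h.carrier) :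
    nullVec ((D.Win q).1.col 1) = (mink q D.h.centre)⁻¹ • D.h.centre := by
  rw [nullVec_col_one, D.frame_Win, ← add_towards, inFrame, sub_neg_eq_add]

theorem nullVec_Wout_zero (q : D.h.carrier) :
    nullVec ((D.Wout q).1.col 0) = (mink q D.h.centre)⁻¹ • D.h.centre := by
  rw [nullVec_col_zero, D.frame_Wout, ← add_towards, outFrame]

theorem nullVec_Wout_one (q : D.h.carrier) :
    nullVec ((D.Wout q).1.col 1) = q - towards q D.h.centre := by
  rw [nullVec_col_one, D.frame_Wout, outFrame]

theorem centre_eq_smul (q : D.h.carrier) :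
    D.h.centre = mink q D.h.centre • nullVec ((D.Win q).1.col 1) := by
  rw [nullVec_Win_one, smul_inv_smul₀ (D.h.mink_centre_pos q).ne']

/-- The parabolic isometries fixing the centre of a spin-decorated horosphere, parametrised by
`s ∈ ℂ` through their conjugates by the spin frame at `q`. -/
noncomputable def parabolic (q : D.h.carrier) (s : ℂ) : SL(2, ℂ) :=
  D.Win q * lowerUnip s * (D.Win q)⁻¹

theorem parabolic_mul_Win (q : D.h.carrier) (s : ℂ) :
    D.parabolic q s * D.Win q = D.Win q * lowerUnip s := inv_mul_cancel_right _ _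

theorem act_parabolic_centre (q : D.h.carrier) (s : ℂ) :
    act (D.parabolic q s) D.h.centre = D.h.centre := by
  rw [D.centre_eq_smul q, act_smul, nullVec_col, ← act_mul, parabolic_mul_Win, ← nullVec_col,
    col_one_mul_lowerUnip, nullVec_col]

/-- The image of the point `q` of the horosphere under `D.parabolic q s`. -/
noncomputable def move (q : D.h.carrier) (s : ℂ) : D.h.carrier :=
  ⟨act (D.parabolic q s) q, Horosphere.act_mem_carrier (D.act_parabolic_centre q s) q⟩

theorem continuous_move (q : D.h.carrier) : Continuous (D.move q) :=
  Continuous.subtype_mk ((continuous_act q).comp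
    ((continuous_const.mul continuous_lowerUnip).mul continuous_const)) _

theorem move_zero (q : D.h.carrier) : D.move q 0 = q := by
  apply Subtype.ext
  simp only [move, parabolic, lowerUnip_zero, mul_one, mul_inv_cancel, act_one]

theorem act_Win_base (q : D.h.carrier) : act (D.Win q) ![1, 0, 0, 0] = q :=
  congrArg Frame.pt (D.frame_Win q)

theorem exists_move_eq (q q' : D.h.carrier) : ∃ s, D.move q s = q' := by
  set x := act (D.Win q)⁻¹ q' with hx
  have act_x : q' = act (D.Win q) x := act_inv_eq_iff.mp hx.symm
  have mink_x_x : mink x x = 1 := by rw [hx, mink_act, (D.h.mem_H3 q').1]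
  have mink_x_null : mink x ![1, 0, 0, -1] = 1 := by
    rw [← mink_act (D.Win q), ← act_x, ← nullVec_single_one, ← nullVec_col, nullVec_Win_one,
      mink_smul_right, D.h.mink_centre_eq q' q, inv_mul_cancel₀ (D.h.mink_centre_pos q).ne']
  refine ⟨x 1 - x 2 * Complex.I, Subtype.ext ?_⟩
  change act (D.parabolic q _) q = q'
  rw [← D.act_Win_base q, ← act_mul, parabolic_mul_Win, act_mul,
    act_lowerUnip_base mink_x_x mink_x_null, ← act_x]

theorem Win_move (q : D.h.carrier) (s : ℂ) : D.Win (D.move q s) = D.Win q * lowerUnip s := by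
  refine congrFun (Spin.lift_unique (D.continuous_Win.comp (D.continuous_move q))
    (c' := fun s => D.Win q * lowerUnip s) (continuous_const.mul continuous_lowerUnip)
    (fun s => ?_) (x₀ := 0) ?_) s
  · rw [← parabolic_mul_Win, Spin.frame_mul, frame_Win, Function.comp_apply, frame_Win]
    exact Horosphere.inFrame_act D.𝒱 (isParabolic_conj_lowerUnip _ s)
      (D.act_parabolic_centre q s) q
  · rw [Function.comp_apply, move_zero, lowerUnip_zero, mul_one]

theorem Win_col_one_eq (q q' : D.h.carrier) : (D.Win q).1.col 1 = (D.Win q').1.col 1 := by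
  obtain ⟨s, rfl⟩ := D.exists_move_eq q' q
  rw [Win_move, col_one_mul_lowerUnip]

/-- The spinor of a spin-decorated horosphere: the second column of its inward spin frames, which
is the same at all points. -/
noncomputable def spinor : Fin 2 → ℂ := (D.Win ⟨_, D.h.nonempty.some_mem⟩).1.col 1

theorem Win_col_one (q : D.h.carrier) : (D.Win q).1.col 1 = D.spinor := D.Win_col_one_eq _ _

theorem Wout_col_zero (q : D.h.carrier) : (D.Wout q).1.col 0 = -D.spinor := by
  rw [← D.Win_col_one q, spinRotate₂_iff.mp (D.associated_in q)]
  ext i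
  rw [Matrix.SpecialLinearGroup.coe_mul]
  simp [rotY, Matrix.mul_apply]

theorem exists_centre_eq_smul : ∃ c : ℝ, 0 < c ∧ D.h.centre = c • nullVec D.spinor :=
  ⟨_, D.h.mink_centre_pos _, D.centre_eq_smul ⟨_, D.h.nonempty.some_mem⟩⟩

variable {D} {D' : SpinDecoratedHorosphere}

theorem sameRay_centre_iff :
    SameRay ℝ D.h.centre D'.h.centre ↔ wedge D.spinor D'.spinor = 0 := by
  obtain ⟨c, hc, centre_eq⟩ := D.exists_centre_eq_smul
  obtain ⟨c', hc', centre_eq'⟩ := D'.exists_centre_eq_smul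
  rw [centre_eq, centre_eq', ← sameRay_nullVec_iff]
  refine ⟨fun h => ?_, fun h => (h.pos_smul_left hc).pos_smul_right hc'⟩
  have := (h.pos_smul_left (inv_pos.mpr hc)).pos_smul_right (inv_pos.mpr hc')
  rwa [inv_smul_smul₀ hc.ne', inv_smul_smul₀ hc'.ne'] at this

theorem mink_centre_pos_of_wedge_ne_zero (h : wedge D.spinor D'.spinor ≠ 0) :
    0 < mink D.h.centre D'.h.centre := by
  obtain ⟨c, hc, centre_eq⟩ := D.exists_centre_eq_smul
  obtain ⟨c', hc', centre_eq'⟩ := D'.exists_centre_eq_smul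
  rw [centre_eq, centre_eq', mink_smul_left, mink_smul_right, mink_nullVec]
  have := Complex.normSq_pos.mpr h
  positivity

theorem isComplexDistance_iff_wedge_spinor {q : D.h.carrier} {q' : D'.h.carrier} {d : ℂ}
    (hq : (q : Mink) ∈ geodesic D.h.centre D'.h.centre)
    (hq' : (q' : Mink) ∈ geodesic D.h.centre D'.h.centre) :
    IsComplexDistance (D.Win q) (D'.Wout q') d ↔
      wedge D.spinor D'.spinor = Complex.exp (d / 2) := by
  have Win_zero : nullVec ((D.Win q).1.col 0) = (mink q D'.h.centre)⁻¹ • D'.h.centre := by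
    rw [nullVec_Win_zero, sub_eq_add_neg,
      ← towards_eq_neg_towards D.h.centre_mem.1 D'.h.centre_mem.1 hq, add_towards]
  have Wout_one : nullVec ((D'.Wout q').1.col 1) = (mink q' D.h.centre)⁻¹ • D.h.centre := by
    rw [geodesic_comm] at hq'
    rw [nullVec_Wout_one, sub_eq_add_neg,
      ← towards_eq_neg_towards D'.h.centre_mem.1 D.h.centre_mem.1 hq', add_towards]
  have wedge_zero :=
    wedge_eq_zero_of_nullVec_eq_smul D'.h.centre_mem.1 Win_zero (D'.nullVec_Wout_zero q')
  have wedge_one :=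
    wedge_eq_zero_of_nullVec_eq_smul D.h.centre_mem.1 Wout_one (D.nullVec_Win_one q)
  rw [isComplexDistance_iff_wedge, and_iff_right wedge_zero, and_iff_right wedge_one,
    Wout_col_zero, Win_col_one, wedge_neg_left, wedge_anticomm]

theorem isLambdaLength_iff {z : ℂ} : IsLambdaLength D D' z ↔ z = wedge D.spinor D'.spinor := by
  rw [IsLambdaLength, sameRay_centre_iff]
  rcases eq_or_ne (wedge D.spinor D'.spinor) 0 with h | h
  · simp only [h, true_and, not_true_eq_false, false_and, or_false]
  simp only [h, false_and, not_false_eq_true, true_and, false_or]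
  constructor
  · rintro ⟨q, q', d, hq, hq', hd, rfl⟩
    exact ((isComplexDistance_iff_wedge_spinor hq hq').mp hd).symm
  · rintro rfl
    have centre_pos := mink_centre_pos_of_wedge_ne_zero h
    obtain ⟨q, hq⟩ := D.h.exists_mem_geodesic D'.h.centre_mem.1 centre_pos
    obtain ⟨q', hq'⟩ := D'.h.exists_mem_geodesic D.h.centre_mem.1 (mink_comm .. ▸ centre_pos)
    rw [geodesic_comm] at hq'
    have exp_log : Complex.exp (2 * Complex.log (wedge D.spinor D'.spinor) / 2) =
        wedge D.spinor D'.spinor := by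
      rw [mul_div_cancel_left₀ _ two_ne_zero, Complex.exp_log h]
    exact ⟨q, q', _, hq, hq', (isComplexDistance_iff_wedge_spinor hq hq').mpr exp_log.symm,
      exp_log.symm⟩

end SpinDecoratedHorosphere

end SpinHoro

theorem theorem1p4 (D : Fin 4 → SpinHoro.SpinDecoratedHorosphere) :
    (∀ i j, ∃! z : ℂ, SpinHoro.IsLambdaLength (D i) (D j) z) ∧
    ∀ lam : Fin 4 → Fin 4 → ℂ,
      (∀ i j, SpinHoro.IsLambdaLength (D i) (D j) (lam i j)) →
        lam 0 2 * lam 1 3 = lam 0 1 * lam 2 3 + lam 0 3 * lam 1 2 := by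
  simp only [SpinHoro.SpinDecoratedHorosphere.isLambdaLength_iff]
  refine ⟨fun _ _ => existsUnique_eq, fun lam lam_eq => ?_⟩
  simp only [lam_eq]
  exact SpinHoro.wedge_mul_wedge fun i => (D i).spinor
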